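/- Let $\mathbb F$ be a field of characteristic $3$ over which every quadratic and every cubic polynomial has a root. A two-dimensional algebra is a two-dimensional $\mathbb F$-vector space $\mathbb A$ with a bilinear multiplication (not necessarily associative, commutative or unital); it is called nontrivial if the multiplication is not identically zero. A nontrivial subalgebra of $\mathbb A$ is a one-dimensional subspace closed under multiplication. A matrix $\begin{pmatrix}\alpha_1&\alpha_2&\alpha_3&\alpha_4\\ \beta_1&\beta_2&\beta_3&\beta_4\end{pmatrix}$ denotes the algebra with basis $e_1,e_2$ and $e_1e_1=\alpha_1e_1+\beta_1e_2$, $e_1e_2=\alpha_2e_1+\beta_2e_2$, $e_2e_1=\alpha_3e_1+\beta_3e_2$, $e_2e_2=\alpha_4e_1+\beta_4e_2$. Consider the canonical algebras (all parameters ranging over $\mathbb F$) - $A_{1,3}(\alpha_1,\alpha_2,\alpha_4,\beta_1)=\begin{pmatrix}\alpha_1&\alpha_2&\alpha_2+1&\alpha_4\\ \beta_1&-\alpha_1&-\alpha_1+1&-\alpha_2\end{pmatrix}$, $\quad A_{2,3}(\alpha_1,\beta_1,\beta_2)=\begin{pmatrix}\alpha_1&0&0&1\\ \beta_1&\beta_2&1-\alpha_1&0\end{pmatrix}$,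 - $A_{3,3}(\beta_1,\beta_2)=\begin{pmatrix}0&1&1&0\\ \beta_1&\beta_2&1&-1\end{pmatrix}$, $\quad A_{4,3}(\alpha_1,\beta_2)=\begin{pmatrix}\alpha_1&0&0&0\\ 0&\beta_2&1-\alpha_1&0\end{pmatrix}$, - $A_{5,3}(\alpha_1)=\begin{pmatrix}\alpha_1&0&0&0\\ 1&-1-\alpha_1&1-\alpha_1&0\end{pmatrix}$, $\quad A_{6,3}(\alpha_1,\beta_1)=\begin{pmatrix}\alpha_1&0&0&1\\ \beta_1&1-\alpha_1&-\alpha_1&0\end{pmatrix}$, - $A_{7,3}(\beta_1)=\begin{pmatrix}0&1&1&0\\ \beta_1&1&0&-1\end{pmatrix}$, $\quad A_{8,3}(\alpha_1)=\begin{pmatrix}\alpha_1&0&0&0\\ 0&1-\alpha_1&-\alpha_1&0\end{pmatrix}$, - $A_{9,3}=\begin{pmatrix}0&1&1&0\\ 1&0&0&-1\end{pmatrix}$, $\quad A_{10,3}=\begin{pmatrix}0&1&1&0\\ 0&0&0&-1\end{pmatrix}$, $\quad A_{11,3}=\begin{pmatrix}1&0&0&0\\ 1&-1&-1&0\end{pmatrix}$,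 $\quad A_{12,3}=\begin{pmatrix}0&0&0&0\\ 1&0&0&0\end{pmatrix}$, and identify $A_{2,3}(\alpha_1,\beta_1,\beta_2)$ with $A_{2,3}(\alpha_1,-\beta_1,\beta_2)$ and $A_{6,3}(\alpha_1,\beta_1)$ with $A_{6,3}(\alpha_1,-\beta_1)$. Consider the following four lists. 1. (one nontrivial subalgebra) $A_{2,3}(\alpha_1,\beta_1,2\alpha_1-1)$; $A_{3,3}(\beta_1,-1)$ with $\beta_1\ne0$; $A_{5,3}(\alpha_1)$; $A_{9,3}$; $A_{11,3}$; $A_{12,3}$. 2. (two nontrivial subalgebras) $A_{1,3}(\alpha_1,\alpha_2,\alpha_4,-\alpha_4-1)$; $A_{3,3}(\beta_1,\beta_2)$ with $\beta_2\ne-1$; $A_{4,3}(\alpha_1,\beta_2)$ with $2\alpha_1-\beta_2-1\ne0$; $A_{7,3}(\beta_1)$; $A_{8,3}(\alpha_1)$. 3. (three nontrivial subalgebras) $A_{1,3}(\alpha_1,\alpha_2,\alpha_4,\beta_1)$ with $\alpha_4(\beta_1+\alpha_4+1)\ne0$; $A_{1,3}(\alpha_1,\alpha_2,0,\beta_1)$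 with $\beta_1\ne-1$; $A_{2,3}(\alpha_1,\beta_1,\beta_2)$ with $\beta_2\ne2\alpha_1-1$; $A_{6,3}(\alpha_1,\beta_1)$. 4. (infinitely many nontrivial subalgebras) $A_{3,3}(0,-1)$; $A_{4,3}(\alpha_1,2\alpha_1-1)$; $A_{10,3}$. Then: (a) A canonical algebra has exactly one (exactly two, exactly three, infinitely many) nontrivial subalgebras if and only if it belongs to list 1 (respectively 2, 3, 4). (b) Every nontrivial two-dimensional algebra over $\mathbb F$ with exactly one (exactly two, exactly three, infinitely many) nontrivial subalgebras is isomorphic to one and, up to the above identification, only one canonical algebra, and that algebra belongs to list 1 (respectively 2, 3, 4). Identified canonical algebras are isomorphic. -/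

import Mathlib

open Polynomial

namespace TwoDimAlg

universe u v w

section General

variable (F : Type u) [Field F]
variable (V : Type v) [NonUnitalNonAssocRing V] [Module F V]
variable (W : Type w) [NonUnitalNonAssocRing W] [Module F W]

/-- The set of nontrivial subalgebras of a two-dimensional algebra, that is, of its
one-dimensional subalgebras. -/
def nontrivialSubalgebras : Set (NonUnitalSubalgebra F V) :=
  {S | Module.finrank F S = 1}

/-- Two (not necessarily associative, not necessarily unital) algebras are isomorphic. -/
def Iso : Prop :=
  ∃ f : V ≃ₗ[F] W, ∀ x y : V, f (x * y) = f x * f y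

end General

/-- The two-dimensional algebra over `F` with basis `e₁, e₂` and matrix of structure constants
`A = (α₁ α₂ α₃ α₄; β₁ β₂ β₃ β₄)`, that is, `e₁e₁ = α₁e₁ + β₁e₂`, `e₁e₂ = α₂e₁ + β₂e₂`,
`e₂e₁ = α₃e₁ + β₃e₂`, `e₂e₂ = α₄e₁ + β₄e₂`. The element `⟨x, y⟩` is `x e₁ + y e₂`. -/
@[ext]
structure MSCAlg {F : Type u} (A : Matrix (Fin 2) (Fin 4) F) : Type u where
  x : F
  y : F

namespace MSCAlg

variable {F : Type u} [Field F] {A : Matrix (Fin 2) (Fin 4) F}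

instance : Zero (MSCAlg A) := ⟨⟨0, 0⟩⟩
instance : Add (MSCAlg A) := ⟨fun u v => ⟨u.x + v.x, u.y + v.y⟩⟩
instance : Neg (MSCAlg A) := ⟨fun u => ⟨-u.x, -u.y⟩⟩
instance : SMul F (MSCAlg A) := ⟨fun c u => ⟨c * u.x, c * u.y⟩⟩
instance : Mul (MSCAlg A) :=
  ⟨fun u v =>
    ⟨A 0 0 * (u.x * v.x) + A 0 1 * (u.x * v.y) + A 0 2 * (u.y * v.x) + A 0 3 * (u.y * v.y),
     A 1 0 * (u.x * v.x) + A 1 1 * (u.x * v.y) + A 1 2 * (u.y * v.x) + A 1 3 * (u.y * v.y)⟩⟩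

@[simp] theorem zero_x : (0 : MSCAlg A).x = 0 := rfl
@[simp] theorem zero_y : (0 : MSCAlg A).y = 0 := rfl
@[simp] theorem add_x (u v : MSCAlg A) : (u + v).x = u.x + v.x := rfl
@[simp] theorem add_y (u v : MSCAlg A) : (u + v).y = u.y + v.y := rfl
@[simp] theorem neg_x (u : MSCAlg A) : (-u).x = -u.x := rfl
@[simp] theorem neg_y (u : MSCAlg A) : (-u).y = -u.y := rfl
@[simp] theorem smul_x (c : F) (u : MSCAlg A) : (c • u).x = c * u.x := rfl
@[simp] theorem smul_y (c : F) (u : MSCAlg A) : (c • u).y = c * u.y := rfl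
@[simp] theorem mul_x (u v : MSCAlg A) : (u * v).x =
    A 0 0 * (u.x * v.x) + A 0 1 * (u.x * v.y) + A 0 2 * (u.y * v.x) + A 0 3 * (u.y * v.y) := rfl
@[simp] theorem mul_y (u v : MSCAlg A) : (u * v).y =
    A 1 0 * (u.x * v.x) + A 1 1 * (u.x * v.y) + A 1 2 * (u.y * v.x) + A 1 3 * (u.y * v.y) := rfl

instance : NonUnitalNonAssocRing (MSCAlg A) where
  add_assoc u v w := by ext <;> simp <;> ring
  zero_add u := by ext <;> simp
  add_zero u := by ext <;> simp
  add_comm u v := by ext <;> simp <;> ring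
  neg_add_cancel u := by ext <;> simp
  nsmul := nsmulRec
  zsmul := zsmulRec
  left_distrib u v w := by ext <;> simp <;> ring
  right_distrib u v w := by ext <;> simp <;> ring
  zero_mul u := by ext <;> simp
  mul_zero u := by ext <;> simp

instance : Module F (MSCAlg A) where
  one_smul u := by ext <;> simp
  mul_smul a b u := by ext <;> simp <;> ring
  smul_zero a := by ext <;> simp
  smul_add a u v := by ext <;> simp <;> ring
  add_smul a b u := by ext <;> simp <;> ring
  zero_smul u := by ext <;> simp

instance : IsScalarTower F (MSCAlg A) (MSCAlg A) where
  smul_assoc c u v := by ext <;> simp <;> ring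

instance : SMulCommClass F (MSCAlg A) (MSCAlg A) where
  smul_comm c u v := by ext <;> simp <;> ring

end MSCAlg

/-- Names of the canonical representatives `A₁,₃(α₁, α₂, α₄, β₁)`, `A₂,₃(α₁, β₁, β₂)`,
`A₃,₃(β₁, β₂)`, `A₄,₃(α₁, β₂)`, `A₅,₃(α₁)`, `A₆,₃(α₁, β₁)`, `A₇,₃(β₁)`, `A₈,₃(α₁)`, `A₉,₃`,
`A₁₀,₃`, `A₁₁,₃`, `A₁₂,₃` in characteristic three, with their parameters in this order. -/
inductive Canon (F : Type u) : Type u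
  | A1 (α₁ α₂ α₄ β₁ : F) : Canon F
  | A2 (α₁ β₁ β₂ : F) : Canon F
  | A3 (β₁ β₂ : F) : Canon F
  | A4 (α₁ β₂ : F) : Canon F
  | A5 (α₁ : F) : Canon F
  | A6 (α₁ β₁ : F) : Canon F
  | A7 (β₁ : F) : Canon F
  | A8 (α₁ : F) : Canon F
  | A9 : Canon F
  | A10 : Canon F
  | A11 : Canon F
  | A12 : Canon F

namespace Canon

variable {F : Type u} [Field F]

/-- The matrix of structure constants of a canonical representative. -/
def msc : Canon F → Matrix (Fin 2) (Fin 4) F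
  | A1 α₁ α₂ α₄ β₁ => !![α₁, α₂, α₂ + 1, α₄; β₁, -α₁, -α₁ + 1, -α₂]
  | A2 α₁ β₁ β₂ => !![α₁, 0, 0, 1; β₁, β₂, 1 - α₁, 0]
  | A3 β₁ β₂ => !![0, 1, 1, 0; β₁, β₂, 1, -1]
  | A4 α₁ β₂ => !![α₁, 0, 0, 0; 0, β₂, 1 - α₁, 0]
  | A5 α₁ => !![α₁, 0, 0, 0; 1, -1 - α₁, 1 - α₁, 0]
  | A6 α₁ β₁ => !![α₁, 0, 0, 1; β₁, 1 - α₁, -α₁, 0]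
  | A7 β₁ => !![0, 1, 1, 0; β₁, 1, 0, -1]
  | A8 α₁ => !![α₁, 0, 0, 0; 0, 1 - α₁, -α₁, 0]
  | A9 => !![0, 1, 1, 0; 1, 0, 0, -1]
  | A10 => !![0, 1, 1, 0; 0, 0, 0, -1]
  | A11 => !![1, 0, 0, 0; 1, -1, -1, 0]
  | A12 => !![0, 0, 0, 0; 1, 0, 0, 0]

/-- The canonical algebra with a given name. -/
abbrev Alg (c : Canon F) : Type u := MSCAlg c.msc

/-- Two names that are equal up to the sign of the parameter `β₁` in the families `A₂,₃` and
`A₆,₃`, the only identification made in the list of canonical representatives. -/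
inductive Same : Canon F → Canon F → Prop
  | refl (c : Canon F) : Same c c
  | sign2 (α₁ β₁ β₂ : F) : Same (A2 α₁ β₁ β₂) (A2 α₁ (-β₁) β₂)
  | sign6 (α₁ β₁ : F) : Same (A6 α₁ β₁) (A6 α₁ (-β₁))

/-- The canonical algebras listed under exactly one nontrivial subalgebra. -/
def listOne : Canon F → Prop
  | A2 α₁ _ β₂ => β₂ = 2 * α₁ - 1
  | A3 β₁ β₂ => β₂ = -1 ∧ β₁ ≠ 0
  | A5 _ => True
  | A9 => True
  | A11 => True
  | A12 => True
  | _ => False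

/-- The canonical algebras listed under exactly two nontrivial subalgebras. -/
def listTwo : Canon F → Prop
  | A1 _ _ α₄ β₁ => β₁ = -α₄ - 1
  | A3 _ β₂ => β₂ ≠ -1
  | A4 α₁ β₂ => 2 * α₁ - β₂ - 1 ≠ 0
  | A7 _ => True
  | A8 _ => True
  | _ => False

/-- The canonical algebras listed under exactly three nontrivial subalgebras. -/
def listThree : Canon F → Prop
  | A1 _ _ α₄ β₁ => α₄ * (β₁ + α₄ + 1) ≠ 0 ∨ (α₄ = 0 ∧ β₁ ≠ -1)
  | A2 α₁ _ β₂ => β₂ ≠ 2 * α₁ - 1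
  | A6 _ _ => True
  | _ => False

/-- The canonical algebras listed under infinitely many nontrivial subalgebras. -/
def listInfinite : Canon F → Prop
  | A3 β₁ β₂ => β₁ = 0 ∧ β₂ = -1
  | A4 α₁ β₂ => β₂ = 2 * α₁ - 1
  | A10 => True
  | _ => False

end Canon

end TwoDimAlg

open TwoDimAlg

/-!
The proof classifies two-dimensional algebras by their two trace forms, that is, the linear forms
`u ↦ tr (v ↦ u v)` and `u ↦ tr (v ↦ v u)`, and counts subalgebras by the roots of a binary cubic.

*Existence of a canonical form* (`exists_canon_iso`). If the trace forms are independent, the basis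
dual to them is canonical, and in it the algebra is some `A₁`. If they are dependent but not both
zero, take `e₂` in their common kernel and `e₁` with value `1` under the right trace form or, if
that one vanishes, under the left one. This leaves `e₁ ↦ e₁ + t e₂`, `e₂ ↦ s e₂`, and
`TraceForm.normalise` uses this freedom to bring `e₂ e₂` to `e₁`, `-e₂` or `0`, which gives the
families `A₂` to `A₅` or `A₆` to `A₈`. If both trace forms vanish, the structure constants satisfy
`α₂ = α₃ = -β₄` and `β₂ = β₃ = -α₁`, and in characteristic three the cubic form `det (u, u u)` is
`β₁ x³ - α₄ y³`. As cube roots exist it has a zero, which serves as `e₂`; the same normalisation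
then leads to `A₉` to `A₁₂`.

*Uniqueness* (`Canon.same_of_basisChange`). An isomorphism respects the trace forms, which leaves
so few changes of basis that comparing structure constants decides the matter.

*Counting* (`encard_nontrivialSubalgebras`). A line `F u` is a subalgebra if and only if `u u` is
proportional to `u`, that is, if `u` is a zero of the cubic form `det (u, u u)`. For each list the
zeros of this form on the projective line are found explicitly or, for three zeros, from the fact
that the form splits and has no double zero. The lists cover all canonical algebras and have
different counts, so each count determines its list.
-/

namespace TwoDimAlg

/-! ### Isomorphisms and changes of basis -/

section Iso

variable {F : Type*} [Field F]

theorem Iso.symm {V W : Type*} [NonUnitalNonAssocRing V] [Module F V] [NonUnitalNonAssocRing W]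
    [Module F W] (h : Iso F V W) : Iso F W V := by
  obtain ⟨f, hf⟩ := h
  exact ⟨f.symm, fun x y => f.injective (by simp [hf])⟩

theorem Iso.trans {V W U : Type*} [NonUnitalNonAssocRing V] [Module F V]
    [NonUnitalNonAssocRing W] [Module F W] [NonUnitalNonAssocRing U] [Module F U]
    (h : Iso F V W) (h' : Iso F W U) : Iso F V U := by
  obtain ⟨f, hf⟩ := h
  obtain ⟨g, hg⟩ := h'
  exact ⟨f.trans g, fun x y => by simp [hf, hg]⟩

/-- `BasisChange B A p q r s` says that in the algebra with matrix of structure constants `A` the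
vectors `p e₁ + q e₂` and `r e₁ + s e₂` form a basis, and that they multiply according to the
matrix `B`. The fields are the coordinates of the products of these vectors. -/
structure BasisChange (B A : Matrix (Fin 2) (Fin 4) F) (p q r s : F) : Prop where
  det_ne : p * s - q * r ≠ 0
  x11 : B 0 0 * p + B 1 0 * r =
    A 0 0 * (p * p) + A 0 1 * (p * q) + A 0 2 * (q * p) + A 0 3 * (q * q)
  y11 : B 0 0 * q + B 1 0 * s =
    A 1 0 * (p * p) + A 1 1 * (p * q) + A 1 2 * (q * p) + A 1 3 * (q * q)
  x12 : B 0 1 * p + B 1 1 * r =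
    A 0 0 * (p * r) + A 0 1 * (p * s) + A 0 2 * (q * r) + A 0 3 * (q * s)
  y12 : B 0 1 * q + B 1 1 * s =
    A 1 0 * (p * r) + A 1 1 * (p * s) + A 1 2 * (q * r) + A 1 3 * (q * s)
  x21 : B 0 2 * p + B 1 2 * r =
    A 0 0 * (r * p) + A 0 1 * (r * q) + A 0 2 * (s * p) + A 0 3 * (s * q)
  y21 : B 0 2 * q + B 1 2 * s =
    A 1 0 * (r * p) + A 1 1 * (r * q) + A 1 2 * (s * p) + A 1 3 * (s * q)
  x22 : B 0 3 * p + B 1 3 * r =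
    A 0 0 * (r * r) + A 0 1 * (r * s) + A 0 2 * (s * r) + A 0 3 * (s * s)
  y22 : B 0 3 * q + B 1 3 * s =
    A 1 0 * (r * r) + A 1 1 * (r * s) + A 1 2 * (s * r) + A 1 3 * (s * s)

variable {A B : Matrix (Fin 2) (Fin 4) F} {p q r s : F}

theorem BasisChange.iso (h : BasisChange B A p q r s) : Iso F (MSCAlg B) (MSCAlg A) := by
  have hd := h.det_ne
  refine ⟨{
    toFun := fun u => ⟨u.x * p + u.y * r, u.x * q + u.y * s⟩
    invFun := fun u => ⟨(s * u.x - r * u.y) / (p * s - q * r),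
      (p * u.y - q * u.x) / (p * s - q * r)⟩
    map_add' := fun u v => by ext <;> simp <;> ring
    map_smul' := fun c u => by ext <;> simp <;> ring
    left_inv := fun u => by
      ext <;> simp only [div_eq_iff hd] <;> ring
    right_inv := fun u => by
      ext <;> simp only [div_mul_eq_mul_div, ← add_div, div_eq_iff hd] <;> ring }, ?_⟩
  intro u v
  ext
  · simp only [LinearEquiv.coe_mk, LinearMap.coe_mk, AddHom.coe_mk, MSCAlg.mul_x, MSCAlg.mul_y]
    linear_combination (u.x * v.x) * h.x11 + (u.x * v.y) * h.x12 + (u.y * v.x) * h.x21 +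
      (u.y * v.y) * h.x22
  · simp only [LinearEquiv.coe_mk, LinearMap.coe_mk, AddHom.coe_mk, MSCAlg.mul_x, MSCAlg.mul_y]
    linear_combination (u.x * v.x) * h.y11 + (u.x * v.y) * h.y12 + (u.y * v.x) * h.y21 +
      (u.y * v.y) * h.y22

theorem Iso.exists_basisChange (h : Iso F (MSCAlg B) (MSCAlg A)) :
    ∃ p q r s, BasisChange B A p q r s := by
  obtain ⟨f, hf⟩ := h
  obtain ⟨p, q, hp⟩ : ∃ p q, f ⟨1, 0⟩ = ⟨p, q⟩ := ⟨_, _, rfl⟩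
  obtain ⟨r, s, hr⟩ : ∃ r s, f ⟨0, 1⟩ = ⟨r, s⟩ := ⟨_, _, rfl⟩
  have key : ∀ x y, f ⟨x, y⟩ = ⟨x * p + y * r, x * q + y * s⟩ := by
    intro x y
    have : (⟨x, y⟩ : MSCAlg B) = x • ⟨1, 0⟩ + y • ⟨0, 1⟩ := by ext <;> simp
    rw [this, map_add, map_smul, map_smul, hp, hr]
    ext <;> simp
  have hz : ∀ x y, x * p + y * r = 0 → x * q + y * s = 0 → x = 0 ∧ y = 0 := by
    intro x y h1 h2
    have h0 : f ⟨x, y⟩ = 0 := by rw [key, h1, h2]; rfl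
    have := (LinearEquiv.map_eq_zero_iff f).1 h0
    exact ⟨congrArg MSCAlg.x this, congrArg MSCAlg.y this⟩
  have eq : ∀ u v : MSCAlg B, f ⟨(u * v).x, (u * v).y⟩ = f u * f v := hf
  have h11 := eq ⟨1, 0⟩ ⟨1, 0⟩
  have h12 := eq ⟨1, 0⟩ ⟨0, 1⟩
  have h21 := eq ⟨0, 1⟩ ⟨1, 0⟩
  have h22 := eq ⟨0, 1⟩ ⟨0, 1⟩
  rw [key, hp, MSCAlg.ext_iff] at h11
  rw [key, hp, hr, MSCAlg.ext_iff] at h12 h21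
  rw [key, hr, MSCAlg.ext_iff] at h22
  simp only [MSCAlg.mul_x, MSCAlg.mul_y, mul_one, mul_zero, add_zero, zero_add] at h11 h12 h21 h22
  refine ⟨p, q, r, s, ?_, h11.1, h11.2, h12.1, h12.2, h21.1, h21.2, h22.1, h22.2⟩
  intro hd
  obtain ⟨h1, h2⟩ := hz s (-q) (by linear_combination hd) (by ring)
  obtain ⟨h3, h4⟩ := hz r (-p) (by ring) (by linear_combination -hd)
  have := hz 1 0 (by simpa using h4) (by simpa using h2)
  exact one_ne_zero this.1

/-- Any two independent vectors are the basis of a change of basis: the new structure constants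
exist. -/
theorem exists_basisChange (A : Matrix (Fin 2) (Fin 4) F) (hd : p * s - q * r ≠ 0) :
    ∃ B, BasisChange B A p q r s := by
  have span : ∀ u v : F, ∃ a b, a * p + b * r = u ∧ a * q + b * s = v := fun u v =>
    ⟨(s * u - r * v) / (p * s - q * r), (p * v - q * u) / (p * s - q * r), by
      simp only [div_mul_eq_mul_div, ← add_div, div_eq_iff hd]; constructor <;> ring⟩
  obtain ⟨a1, b1, h1, h1'⟩ := span
    (A 0 0 * (p * p) + A 0 1 * (p * q) + A 0 2 * (q * p) + A 0 3 * (q * q))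
    (A 1 0 * (p * p) + A 1 1 * (p * q) + A 1 2 * (q * p) + A 1 3 * (q * q))
  obtain ⟨a2, b2, h2, h2'⟩ := span
    (A 0 0 * (p * r) + A 0 1 * (p * s) + A 0 2 * (q * r) + A 0 3 * (q * s))
    (A 1 0 * (p * r) + A 1 1 * (p * s) + A 1 2 * (q * r) + A 1 3 * (q * s))
  obtain ⟨a3, b3, h3, h3'⟩ := span
    (A 0 0 * (r * p) + A 0 1 * (r * q) + A 0 2 * (s * p) + A 0 3 * (s * q))
    (A 1 0 * (r * p) + A 1 1 * (r * q) + A 1 2 * (s * p) + A 1 3 * (s * q))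
  obtain ⟨a4, b4, h4, h4'⟩ := span
    (A 0 0 * (r * r) + A 0 1 * (r * s) + A 0 2 * (s * r) + A 0 3 * (s * s))
    (A 1 0 * (r * r) + A 1 1 * (r * s) + A 1 2 * (s * r) + A 1 3 * (s * s))
  exact ⟨!![a1, a2, a3, a4; b1, b2, b3, b4], hd, h1, h1', h2, h2', h3, h3', h4, h4'⟩

/-! The traces of the left and right multiplications by `e₁`, `e₂` are, in terms of the matrix of
structure constants, `α₁ + β₂`, `α₃ + β₄` (left) and `α₁ + β₃`, `α₂ + β₄` (right). The next four
lemmas say that they are linear forms on the algebra, independent of the basis. -/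

theorem BasisChange.trL₁ (h : BasisChange B A p q r s) :
    B 0 0 + B 1 1 = p * (A 0 0 + A 1 1) + q * (A 0 2 + A 1 3) := by
  apply mul_left_cancel₀ h.det_ne
  -- the trace of `adj P * (P * X - Y * P)` is `det P * (tr X - tr Y)`
  linear_combination s * h.x11 - r * h.y11 - q * h.x12 + p * h.y12

theorem BasisChange.trL₂ (h : BasisChange B A p q r s) :
    B 0 2 + B 1 3 = r * (A 0 0 + A 1 1) + s * (A 0 2 + A 1 3) := by
  apply mul_left_cancel₀ h.det_ne
  linear_combination s * h.x21 - r * h.y21 - q * h.x22 + p * h.y22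

theorem BasisChange.trR₁ (h : BasisChange B A p q r s) :
    B 0 0 + B 1 2 = p * (A 0 0 + A 1 2) + q * (A 0 1 + A 1 3) := by
  apply mul_left_cancel₀ h.det_ne
  linear_combination s * h.x11 - r * h.y11 - q * h.x21 + p * h.y21

theorem BasisChange.trR₂ (h : BasisChange B A p q r s) :
    B 0 1 + B 1 3 = r * (A 0 0 + A 1 2) + s * (A 0 1 + A 1 3) := by
  apply mul_left_cancel₀ h.det_ne
  linear_combination s * h.x12 - r * h.y12 - q * h.x22 + p * h.y22

/-- A two-dimensional algebra is given by a matrix of structure constants. -/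
theorem exists_iso_mscAlg {V : Type*} [NonUnitalNonAssocRing V] [Module F V]
    [IsScalarTower F V V] [SMulCommClass F V V] (hV : Module.finrank F V = 2) :
    ∃ A : Matrix (Fin 2) (Fin 4) F, Iso F (MSCAlg A) V := by
  have : FiniteDimensional F V := Module.finite_of_finrank_pos (by omega)
  let b := Module.finBasisOfFinrankEq F V hV
  have hb : ∀ v : V, ∃ c d : F, v = c • b 0 + d • b 1 := fun v => ⟨b.repr v 0, b.repr v 1, by
    conv_lhs => rw [← b.sum_repr v, Fin.sum_univ_two]⟩
  obtain ⟨a1, b1, h1⟩ := hb (b 0 * b 0)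
  obtain ⟨a2, b2, h2⟩ := hb (b 0 * b 1)
  obtain ⟨a3, b3, h3⟩ := hb (b 1 * b 0)
  obtain ⟨a4, b4, h4⟩ := hb (b 1 * b 1)
  refine ⟨!![a1, a2, a3, a4; b1, b2, b3, b4], {
    toFun := fun u => u.x • b 0 + u.y • b 1
    invFun := fun v => ⟨b.repr v 0, b.repr v 1⟩
    map_add' := fun u v => by simp only [MSCAlg.add_x, MSCAlg.add_y]; module
    map_smul' := fun c u => by
      simp only [MSCAlg.smul_x, MSCAlg.smul_y, RingHom.id_apply]; module
    left_inv := fun u => by ext <;> simp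
    right_inv := fun v => by
      conv_rhs => rw [← b.sum_repr v, Fin.sum_univ_two] }, ?_⟩
  intro u v
  simp only [LinearEquiv.coe_mk, LinearMap.coe_mk, AddHom.coe_mk, MSCAlg.mul_x, MSCAlg.mul_y,
    add_mul, mul_add, smul_mul_smul_comm, h1, h2, h3, h4]
  simp only [Matrix.of_apply, Matrix.cons_val', Matrix.cons_val]
  module

end Iso

/-! ### One-dimensional subalgebras and the roots of a binary cubic form -/

section Count

variable {F : Type*} [Field F]

theorem Iso.encard_nontrivialSubalgebras {V W : Type*} [NonUnitalNonAssocRing V] [Module F V]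
    [NonUnitalNonAssocRing W] [Module F W] (h : Iso F V W) :
    (nontrivialSubalgebras F V).encard = (nontrivialSubalgebras F W).encard := by
  obtain ⟨f, hf⟩ := h
  let g : V →ₙₐ[F] W :=
    { toFun := f, map_smul' := map_smul f, map_zero' := map_zero f, map_add' := map_add f,
      map_mul' := hf }
  let k : W →ₙₐ[F] V :=
    { toFun := f.symm, map_smul' := map_smul f.symm, map_zero' := map_zero f.symm,
      map_add' := map_add f.symm, map_mul' := fun x y => f.injective (by simp [hf]) }
  have hinj : Function.Injective (NonUnitalSubalgebra.map g) :=
    NonUnitalSubalgebra.map_injective (f := g) f.injective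
  rw [← hinj.encard_image]
  congr 1
  ext S
  constructor
  · rintro ⟨T, hT, rfl⟩
    exact (LinearEquiv.finrank_eq (f.submoduleMap T.toSubmodule)).symm.trans hT
  · intro hS
    refine ⟨S.map k, (LinearEquiv.finrank_eq (f.symm.submoduleMap S.toSubmodule)).symm.trans hS, ?_⟩
    rw [NonUnitalSubalgebra.map_map]
    convert NonUnitalSubalgebra.map_id S
    ext x
    exact f.apply_symm_apply x

/-- The points of the projective line over `F`, encoded as `Option F`: the point `some t` is the
line through `e₁ + t e₂`, and `none` is the line through `e₂`. -/
def lineGen (A : Matrix (Fin 2) (Fin 4) F) : Option F → MSCAlg A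
  | none => ⟨0, 1⟩
  | some t => ⟨1, t⟩

/-- The lines that are closed under multiplication. On the line through `x e₁ + y e₂` this is
the vanishing of the cubic form `det (u, u * u)`, where `u = x e₁ + y e₂`, written out here in the
two charts of `lineGen`. -/
def closedLines (A : Matrix (Fin 2) (Fin 4) F) : Set (Option F)
  | none => A 0 3 = 0
  | some t => A 1 0 + (A 1 1 + A 1 2 - A 0 0) * t + (A 1 3 - A 0 1 - A 0 2) * t ^ 2
      - A 0 3 * t ^ 3 = 0

variable {A : Matrix (Fin 2) (Fin 4) F}

@[simp] theorem none_mem_closedLines : none ∈ closedLines A ↔ A 0 3 = 0 := Iff.rfl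

@[simp] theorem some_mem_closedLines {t : F} : some t ∈ closedLines A ↔
    A 1 0 + (A 1 1 + A 1 2 - A 0 0) * t + (A 1 3 - A 0 1 - A 0 2) * t ^ 2
      - A 0 3 * t ^ 3 = 0 := Iff.rfl

theorem lineGen_ne_zero (o : Option F) : lineGen A o ≠ 0 := by
  intro h
  cases o
  · exact one_ne_zero (congrArg MSCAlg.y h)
  · exact one_ne_zero (congrArg MSCAlg.x h)

theorem lineGen_injective_line {o o' : Option F} {c : F}
    (h : c • lineGen A o = lineGen A o') : o = o' := by
  have hx := congrArg MSCAlg.x h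
  have hy := congrArg MSCAlg.y h
  cases o <;> cases o' <;> simp [lineGen] at hx hy ⊢
  · simp [hx] at hy
  · simpa [hx] using hy

theorem exists_smul_lineGen {v : MSCAlg A} (hv : v ≠ 0) :
    ∃ (o : Option F) (c : F), c ≠ 0 ∧ v = c • lineGen A o := by
  by_cases hx : v.x = 0
  · refine ⟨none, v.y, fun hy => hv (by ext <;> simp [hx, hy]), ?_⟩
    ext <;> simp [lineGen, hx]
  · refine ⟨some (v.y / v.x), v.x, hx, ?_⟩
    ext <;> simp [lineGen, mul_div_cancel₀, hx]

theorem mem_closedLines_iff {o : Option F} :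
    o ∈ closedLines A ↔ ∃ c : F, lineGen A o * lineGen A o = c • lineGen A o := by
  cases o with
  | none => simp [lineGen, MSCAlg.ext_iff]
  | some t =>
    simp only [some_mem_closedLines, lineGen, MSCAlg.ext_iff, MSCAlg.mul_x, MSCAlg.mul_y,
      MSCAlg.smul_x, MSCAlg.smul_y]
    constructor
    · intro h
      exact ⟨_, (mul_one _).symm, by linear_combination h⟩
    · rintro ⟨c, h1, h2⟩
      linear_combination h2 - t * h1

/-- The one-dimensional subalgebra given by a closed line. -/
def lineSubalgebra (o : closedLines A) : NonUnitalSubalgebra F (MSCAlg A) where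
  toNonUnitalSubsemiring :=
    { (F ∙ lineGen A o.1).toAddSubmonoid with
      mul_mem' := by
        rintro a b ha hb
        obtain ⟨a, rfl⟩ := Submodule.mem_span_singleton.1 ha
        obtain ⟨b, rfl⟩ := Submodule.mem_span_singleton.1 hb
        obtain ⟨c, hc⟩ := mem_closedLines_iff.1 o.2
        refine Submodule.mem_span_singleton.2 ⟨a * b * c, ?_⟩
        rw [smul_mul_smul_comm, hc, smul_smul] }
  smul_mem' c _ hx := (F ∙ lineGen A o.1).smul_mem c hx

theorem mem_lineSubalgebra {o : closedLines A} {v : MSCAlg A} :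
    v ∈ lineSubalgebra o ↔ ∃ c : F, c • lineGen A o.1 = v :=
  Submodule.mem_span_singleton

theorem encard_nontrivialSubalgebras (A : Matrix (Fin 2) (Fin 4) F) :
    (nontrivialSubalgebras F (MSCAlg A)).encard = (closedLines A).encard := by
  have hinj : Function.Injective (lineSubalgebra (A := A)) := by
    intro o o' h
    have : lineGen A o'.1 ∈ lineSubalgebra o :=
      h ▸ mem_lineSubalgebra.2 ⟨1, one_smul _ _⟩
    obtain ⟨c, hc⟩ := mem_lineSubalgebra.1 this
    exact Subtype.ext (lineGen_injective_line hc)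
  have hrange : Set.range (lineSubalgebra (A := A)) = nontrivialSubalgebras F (MSCAlg A) := by
    ext S
    constructor
    · rintro ⟨o, rfl⟩
      exact finrank_span_singleton (lineGen_ne_zero o.1)
    · intro hS
      obtain ⟨⟨v, hvS⟩, hv0, hv⟩ := finrank_eq_one_iff'.1 hS
      have hv0 : v ≠ 0 := fun h => hv0 (Subtype.ext h)
      have hv : ∀ w ∈ S, ∃ c : F, c • v = w := fun w hw => by
        obtain ⟨c, hc⟩ := hv ⟨w, hw⟩
        exact ⟨c, congrArg Subtype.val hc⟩
      obtain ⟨o, c, hc, rfl⟩ := exists_smul_lineGen hv0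
      have ho : lineGen A o ∈ S := by
        have := S.smul_mem' c⁻¹ hvS
        rwa [smul_smul, inv_mul_cancel₀ hc, one_smul] at this
      have hmul : ∀ w ∈ S, ∃ d : F, d • lineGen A o = w := fun w hw => by
        obtain ⟨d, rfl⟩ := hv w hw
        exact ⟨d * c, (smul_smul _ _ _).symm⟩
      have hcl : o ∈ closedLines A := by
        obtain ⟨d, hd⟩ := hmul _ (S.mul_mem ho ho)
        exact mem_closedLines_iff.2 ⟨d, hd.symm⟩
      refine ⟨⟨o, hcl⟩, ?_⟩
      ext w
      rw [mem_lineSubalgebra]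
      constructor
      · rintro ⟨d, rfl⟩
        exact S.smul_mem' d ho
      · exact hmul w
  rw [← hrange, ← Set.image_univ, hinj.encard_image, Set.encard_univ, ENat.card_coe_set_eq]

end Count

/-! ### Roots of polynomials of degree two and three -/

section Roots

variable {F : Type*} [Field F]

/-- Every quadratic and every cubic polynomial over `F` has a root. -/
def HasRootsTwoThree (F : Type*) [Field F] : Prop :=
  ∀ p : F[X], p.natDegree = 2 ∨ p.natDegree = 3 → ∃ x : F, p.IsRoot x

theorem exists_quadratic_root
    (hF : HasRootsTwoThree F) (b c : F) :
    ∃ x, x ^ 2 + b * x + c = 0 := by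
  obtain ⟨x, hx⟩ := hF (X ^ 2 + C b * X + C c) (Or.inl (by compute_degree!))
  exact ⟨x, by simpa using hx⟩

theorem exists_cubic_root
    (hF : HasRootsTwoThree F) (b c d : F) :
    ∃ x, x ^ 3 + b * x ^ 2 + c * x + d = 0 := by
  obtain ⟨x, hx⟩ := hF (X ^ 3 + C b * X ^ 2 + C c * X + C d) (Or.inr (by compute_degree!))
  exact ⟨x, by simpa using hx⟩

theorem exists_cubic_roots
    (hF : HasRootsTwoThree F) (b c d : F) :
    ∃ x y z, b = -(x + y + z) ∧ c = x * y + x * z + y * z ∧ d = -(x * y * z) := by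
  obtain ⟨x, hx⟩ := exists_cubic_root hF b c d
  obtain ⟨y, hy⟩ := exists_quadratic_root hF (b + x) (c + x * (b + x))
  refine ⟨x, y, -(b + x) - y, by ring, by linear_combination hy, ?_⟩
  linear_combination hx - x * hy

theorem infinite_of_exists_root [CharP F 3]
    (hF : HasRootsTwoThree F) :
    Infinite F := by
  by_contra h
  have : Finite F := not_infinite_iff_finite.1 h
  -- over a finite field squaring would be bijective, but `1` and `-1` have the same square
  have hsurj : Function.Surjective (fun x : F => x ^ 2) := fun a => by
    obtain ⟨x, hx⟩ := exists_quadratic_root hF 0 (-a)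
    exact ⟨x, by linear_combination hx⟩
  have h1 : (1 : F) = -1 := (Finite.injective_iff_surjective.2 hsurj) (by norm_num)
  have h3 : (3 : F) = 0 := CharP.cast_eq_zero F 3
  exact one_ne_zero (α := F) (by linear_combination h3 - h1)

end Roots

/-! ### The number of subalgebras of the canonical algebras -/

namespace Canon

variable {F : Type*} [Field F] [CharP F 3]

theorem mem_some_list (c : Canon F) :
    c.listOne ∨ c.listTwo ∨ c.listThree ∨ c.listInfinite := by
  cases c <;> simp only [listOne, listTwo, listThree, listInfinite] <;> try tauto
  all_goals grind

theorem encard_closedLines_of_listOne (hF : HasRootsTwoThree F) {c : Canon F} (hc : c.listOne) :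
    (closedLines c.msc).encard = 1 := by
  have h3 : (3 : F) = 0 := CharP.cast_eq_zero F 3
  rw [Set.encard_eq_one]
  cases c <;> simp only [listOne] at hc
  case A2 α₁ β₁ β₂ =>
    obtain ⟨b, hb⟩ := exists_cubic_root hF 0 0 (-β₁)
    refine ⟨some b, Set.ext fun o => ?_⟩
    cases o with
    | none => simp [msc]
    | some t =>
      have : β₁ + (β₂ + (1 - α₁) - α₁) * t + (0 - 0 - 0) * t ^ 2 - 1 * t ^ 3 = (b - t) ^ 3 := by
        subst hc
        linear_combination (-1 : F) * hb + (b ^ 2 * t - b * t ^ 2) * h3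
      have key : some t ∈ closedLines (A2 α₁ β₁ β₂).msc ↔ (b - t) ^ 3 = 0 := by
        rw [← this]; rfl
      rw [key, pow_eq_zero_iff three_ne_zero, sub_eq_zero, Set.mem_singleton_iff,
        Option.some_inj, eq_comm]
  all_goals
    refine ⟨none, Set.ext fun o => ?_⟩
    cases o <;> simp [msc]
  all_goals grind

theorem encard_closedLines_of_listTwo {c : Canon F} (hc : c.listTwo) :
    (closedLines c.msc).encard = 2 := by
  have h3 : (3 : F) = 0 := CharP.cast_eq_zero F 3
  rw [Set.encard_eq_two]
  cases c <;> simp only [listTwo] at hc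
  case A1 α₁ α₂ α₄ β₁ =>
    by_cases h : α₄ = 0
    · refine ⟨none, some (-1), by simp, Set.ext fun o => ?_⟩
      cases o <;> simp [msc] <;> grind
    · -- the cubic has the double root `-1`
      refine ⟨some (-1), some (-(1 + α₄) / α₄), by simp; grind, Set.ext fun o => ?_⟩
      cases o <;> simp [msc] <;> grind
  case A3 β₁ β₂ =>
    refine ⟨none, some (-β₁ / (β₂ + 1)), by simp, Set.ext fun o => ?_⟩
    cases o <;> simp [msc]
    grind
  case A4 α₁ β₂ =>
    refine ⟨none, some 0, by simp, Set.ext fun o => ?_⟩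
    cases o <;> simp [msc]
    grind
  case A7 β₁ =>
    refine ⟨none, some (-β₁), by simp, Set.ext fun o => ?_⟩
    cases o <;> simp [msc]
    grind
  case A8 α₁ =>
    refine ⟨none, some 0, by simp, Set.ext fun o => ?_⟩
    cases o <;> simp [msc]
    grind

theorem encard_closedLines_of_listThree (hF : HasRootsTwoThree F) {c : Canon F}
    (hc : c.listThree) : (closedLines c.msc).encard = 3 := by
  have h3 : (3 : F) = 0 := CharP.cast_eq_zero F 3
  rw [Set.encard_eq_three]
  have main : ∀ A : Matrix (Fin 2) (Fin 4) F, A 0 3 ≠ 0 →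
      (∀ x y z, A 1 0 = A 0 3 * (x * y * z) →
        A 1 1 + A 1 2 - A 0 0 = A 0 3 * -(x * y + x * z + y * z) →
        A 1 3 - A 0 1 - A 0 2 = A 0 3 * (x + y + z) → x ≠ y) →
      ∃ x y z, x ≠ y ∧ x ≠ z ∧ y ≠ z ∧ closedLines A = {x, y, z} := by
    intro A ha hne
    obtain ⟨x, y, z, hb, hc, hd⟩ := exists_cubic_roots hF (-(A 1 3 - A 0 1 - A 0 2) / A 0 3)
      (-(A 1 1 + A 1 2 - A 0 0) / A 0 3) (-A 1 0 / A 0 3)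
    rw [div_eq_iff ha] at hb hc hd
    -- the hypothesis on the roots is symmetric in them
    have hxy : x ≠ y := hne x y z (by linear_combination -hd) (by linear_combination -hc)
      (by linear_combination -hb)
    have hxz : x ≠ z := hne x z y (by linear_combination -hd) (by linear_combination -hc)
      (by linear_combination -hb)
    have hyz : y ≠ z := hne y z x (by linear_combination -hd) (by linear_combination -hc)
      (by linear_combination -hb)
    refine ⟨some x, some y, some z, by simpa, by simpa, by simpa, Set.ext fun o => ?_⟩
    cases o with
    | none => simp [ha]
    | some t =>
      have key : A 1 0 + (A 1 1 + A 1 2 - A 0 0) * t + (A 1 3 - A 0 1 - A 0 2) * t ^ 2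
          - A 0 3 * t ^ 3 = -A 0 3 * ((t - x) * ((t - y) * (t - z))) := by
        linear_combination -hd - t * hc - t ^ 2 * hb
      simp [key, ha, sub_eq_zero]
  cases c <;> simp only [listThree] at hc
  case A1 α₁ α₂ α₄ β₁ =>
    by_cases h : α₄ = 0
    · obtain ⟨d, hd⟩ := exists_quadratic_root hF 0 (-(1 + β₁))
      refine ⟨none, some (-1 + d), some (-1 - d), by simp, by simp, by simp; grind,
        Set.ext fun o => ?_⟩
      cases o <;> simp [msc] <;> grind
    · refine main _ h fun x y z h1 h2 h3 => ?_
      simp [msc] at h1 h2 h3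
      grind
  case A2 α₁ β₁ β₂ =>
    refine main _ (by simp [msc]) fun x y z h1 h2 h3 => ?_
    simp [msc] at h1 h2 h3
    grind
  case A6 α₁ β₁ =>
    refine main _ (by simp [msc]) fun x y z h1 h2 h3 => ?_
    simp [msc] at h1 h2 h3
    grind

theorem infinite_closedLines_of_listInfinite (hF : HasRootsTwoThree F) {c : Canon F}
    (hc : c.listInfinite) : (closedLines c.msc).Infinite := by
  have h3 : (3 : F) = 0 := CharP.cast_eq_zero F 3
  have := infinite_of_exists_root hF
  have huniv : closedLines c.msc = Set.univ := by
    refine Set.eq_univ_of_forall fun o => ?_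
    cases c <;> simp only [listInfinite] at hc
    all_goals cases o <;> simp [msc]
    all_goals grind
  rw [huniv]
  exact Set.infinite_univ

end Canon

/-! ### Existence of a canonical form -/

section Existence

theorem msc_ext {F : Type*} {A B : Matrix (Fin 2) (Fin 4) F} (h00 : A 0 0 = B 0 0) (h01 : A 0 1 = B 0 1)
    (h02 : A 0 2 = B 0 2) (h03 : A 0 3 = B 0 3) (h10 : A 1 0 = B 1 0) (h11 : A 1 1 = B 1 1)
    (h12 : A 1 2 = B 1 2) (h13 : A 1 3 = B 1 3) : A = B := by
  ext i j
  fin_cases i <;> fin_cases j <;> assumption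

variable {F : Type*} [Field F] {A : Matrix (Fin 2) (Fin 4) F}

/-- `TraceForm A l m` says that `e₂` lies in the kernel of both trace forms and that the traces of
the left and right multiplications by `e₁` are `l` and `m`. -/
structure TraceForm (A : Matrix (Fin 2) (Fin 4) F) (l m : F) : Prop where
  l₁ : A 0 0 + A 1 1 = l
  l₂ : A 0 2 + A 1 3 = 0
  m₁ : A 0 0 + A 1 2 = m
  m₂ : A 0 1 + A 1 3 = 0

theorem TraceForm.of_basisChange {B : Matrix (Fin 2) (Fin 4) F} {l m q s : F}
    (hA : TraceForm A l m) (h : BasisChange B A 1 q 0 s) : TraceForm B l m where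
  l₁ := by rw [h.trL₁, hA.l₁, hA.l₂]; ring
  l₂ := by rw [h.trL₂, hA.l₁, hA.l₂]; ring
  m₁ := by rw [h.trR₁, hA.m₁, hA.m₂]; ring
  m₂ := by rw [h.trR₂, hA.m₁, hA.m₂]; ring

/-- The normalisation that is possible while the kernel line of the trace forms is kept: the
vector `e₂` may be scaled, and multiples of `e₂` may be added to `e₁`. -/
theorem TraceForm.normalise [CharP F 3] (hF : HasRootsTwoThree F) {l m : F}
    (hA : TraceForm A l m) :
    ∃ B : Matrix (Fin 2) (Fin 4) F, Iso F (MSCAlg B) (MSCAlg A) ∧ TraceForm B l m ∧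
      (A 0 3 = 0 → B 0 3 = 0) ∧
      (B 0 3 = 1 ∧ B 1 3 = 0 ∨ B 0 3 = 0 ∧ B 1 3 = -1 ∧ B 0 0 = 0 ∨
        B 0 3 = 0 ∧ B 1 3 = 0 ∧ (l + m ≠ 0 ∧ B 1 0 = 0 ∨ l + m = 0 ∧ (B 1 0 = 0 ∨ B 1 0 = 1))) := by
  have h3 : (3 : F) = 0 := CharP.cast_eq_zero F 3
  obtain ⟨t, s, hs, hts⟩ : ∃ t s : F, s ≠ 0 ∧ ∀ B : Matrix (Fin 2) (Fin 4) F,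
      BasisChange B A 1 t 0 s → TraceForm B l m → (A 0 3 = 0 → B 0 3 = 0) ∧
      (B 0 3 = 1 ∧ B 1 3 = 0 ∨ B 0 3 = 0 ∧ B 1 3 = -1 ∧ B 0 0 = 0 ∨
        B 0 3 = 0 ∧ B 1 3 = 0 ∧
          (l + m ≠ 0 ∧ B 1 0 = 0 ∨ l + m = 0 ∧ (B 1 0 = 0 ∨ B 1 0 = 1))) := by
    obtain ⟨l1, l2, m1, m2⟩ := hA
    by_cases h03 : A 0 3 = 0
    · by_cases h13 : A 1 3 = 0
      · by_cases hlm : l + m = 0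
        · by_cases h10 : A 1 0 = 0
          · refine ⟨0, 1, one_ne_zero, fun B hB hT => ?_⟩
            have := hB.x22; have := hB.y22; have := hB.y11
            grind
          · refine ⟨0, A 1 0, h10, fun B hB hT => ?_⟩
            have := hB.x22; have := hB.y22; have := hB.y11
            grind
        · refine ⟨-A 1 0 / (l + m), 1, one_ne_zero, fun B hB hT => ?_⟩
          have := hB.x22; have := hB.y22; have := hB.y11; have := hB.x11
          have h : B 1 0 = 0 := by grind
          grind
      · -- with `e₂ e₂ = -e₂`, adding `t e₂` to `e₁` changes `α₁` by `2 t = -t`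
        refine ⟨-A 0 0 / A 1 3, -1 / A 1 3, by simpa, fun B hB hT => ?_⟩
        have := hB.x22; have := hB.y22; have := hB.y11; have := hB.x11
        grind
    · obtain ⟨s, hs⟩ := exists_quadratic_root hF 0 (-1 / A 0 3)
      refine ⟨A 1 3 / A 0 3, s, ?_, fun B hB hT => ?_⟩
      · rintro rfl
        simp [h03] at hs
      · have := hB.x22; have := hB.y22
        have h1 : s * s * A 0 3 = 1 := by grind
        have h2 : B 0 3 = 1 := by grind
        have : B 1 3 = 0 := by
          have : s ≠ 0 := by grind
          have : B 1 3 * s = 0 := by grind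
          grind
        grind
  obtain ⟨B, hB⟩ := exists_basisChange A (p := 1) (q := t) (r := 0) (s := s) (by simpa)
  have hT := hA.of_basisChange hB
  exact ⟨B, hB.iso, hT, hts B hB hT⟩

open Canon in
theorem TraceForm.exists_canon [CharP F 3] (hF : HasRootsTwoThree F) {l m : F}
    (hA : TraceForm A l m) (hlm : m = 1 ∨ m = 0 ∧ l = 1) :
    ∃ c : Canon F, Iso F c.Alg (MSCAlg A) := by
  have h3 : (3 : F) = 0 := CharP.cast_eq_zero F 3
  obtain ⟨B, hiso, ⟨l1, l2, m1, m2⟩, -, hB⟩ := hA.normalise hF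
  suffices ∃ c : Canon F, c.msc = B by
    obtain ⟨c, rfl⟩ := this
    exact ⟨c, hiso⟩
  rcases hlm with rfl | ⟨rfl, rfl⟩
  · rcases hB with hB | hB | ⟨h03, h13, hB⟩
    · exact ⟨A2 (B 0 0) (B 1 0) (B 1 1), by apply msc_ext <;> simp [msc] <;> grind⟩
    · exact ⟨A3 (B 1 0) (B 1 1), by apply msc_ext <;> simp [msc] <;> grind⟩
    · by_cases h10 : B 1 0 = 0
      · exact ⟨A4 (B 0 0) (B 1 1), by apply msc_ext <;> simp [msc] <;> grind⟩
      · exact ⟨A5 (B 0 0), by apply msc_ext <;> simp [msc] <;> grind⟩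
  · rcases hB with hB | hB | ⟨h03, h13, hB⟩
    · exact ⟨A6 (B 0 0) (B 1 0), by apply msc_ext <;> simp [msc] <;> grind⟩
    · exact ⟨A7 (B 1 0), by apply msc_ext <;> simp [msc] <;> grind⟩
    · exact ⟨A8 (B 0 0), by apply msc_ext <;> simp [msc] <;> grind⟩

open Canon in
theorem TraceForm.exists_canon_zero [CharP F 3] (hF : HasRootsTwoThree F)
    (hA : TraceForm A 0 0) (h03 : A 0 3 = 0) (hne : ∃ u v : MSCAlg A, u * v ≠ 0) :
    ∃ c : Canon F, Iso F c.Alg (MSCAlg A) := by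
  have h3 : (3 : F) = 0 := CharP.cast_eq_zero F 3
  obtain ⟨B, hiso, ⟨l1, l2, m1, m2⟩, hB03, hB⟩ := hA.normalise hF
  suffices ∃ c : Canon F, Iso F c.Alg (MSCAlg B) by
    obtain ⟨c, hc⟩ := this
    exact ⟨c, hc.trans hiso⟩
  have hne : ∃ u v : MSCAlg B, u * v ≠ 0 := by
    obtain ⟨f, hf⟩ := hiso.symm
    obtain ⟨u, v, huv⟩ := hne
    exact ⟨f u, f v, by rwa [← hf, Ne, LinearEquiv.map_eq_zero_iff]⟩
  have hB03 := hB03 h03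
  rcases hB with hB | ⟨-, h13, h00⟩ | ⟨-, h13, hB⟩
  · simp [hB03] at hB
  · by_cases h10 : B 1 0 = 0
    · exact ⟨A10, BasisChange.iso (p := 1) (q := 0) (r := 0) (s := 1)
        (by constructor <;> simp [msc] <;> grind)⟩
    · obtain ⟨r, hr⟩ := exists_quadratic_root hF 0 (-1 / B 1 0)
      have hr : r * r * B 1 0 = 1 := by grind
      exact ⟨A9, BasisChange.iso (p := r) (q := 0) (r := 0) (s := 1)
        (by constructor <;> simp [msc] <;> grind)⟩
  · by_cases h00 : B 0 0 = 0
    · by_cases h10 : B 1 0 = 0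
      · obtain ⟨u, v, huv⟩ := hne
        refine absurd ?_ huv
        have : B = 0 := by apply msc_ext <;> simp <;> grind
        subst this
        ext <;> simp
      · exact ⟨A12, BasisChange.iso (p := 1) (q := 0) (r := 0) (s := 1)
          (by constructor <;> simp [msc] <;> grind)⟩
    · by_cases h10 : B 1 0 = 0
      · exact ⟨A10, BasisChange.iso (p := 0) (q := 1) (r := -1 / B 0 0) (s := 0)
          (by constructor <;> simp [msc] <;> grind)⟩
      · exact ⟨A11, BasisChange.iso (p := 1 / B 0 0) (q := 0) (r := 0) (s := 1 / (B 0 0) ^ 2)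
          (by constructor <;> simp [msc] <;> grind)⟩

open Canon in
theorem exists_canon_iso [CharP F 3] (hF : HasRootsTwoThree F)
    (hne : ∃ u v : MSCAlg A, u * v ≠ 0) : ∃ c : Canon F, Iso F c.Alg (MSCAlg A) := by
  have h3 : (3 : F) = 0 := CharP.cast_eq_zero F 3
  obtain ⟨l₁, hl₁⟩ : ∃ x, A 0 0 + A 1 1 = x := ⟨_, rfl⟩
  obtain ⟨l₂, hl₂⟩ : ∃ x, A 0 2 + A 1 3 = x := ⟨_, rfl⟩
  obtain ⟨m₁, hm₁⟩ : ∃ x, A 0 0 + A 1 2 = x := ⟨_, rfl⟩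
  obtain ⟨m₂, hm₂⟩ : ∃ x, A 0 1 + A 1 3 = x := ⟨_, rfl⟩
  -- it suffices to pass to a suitable basis
  have pass : ∀ p q r s : F, p * s - q * r ≠ 0 →
      (∀ B, BasisChange B A p q r s → (∃ u v : MSCAlg B, u * v ≠ 0) →
        ∃ c : Canon F, Iso F c.Alg (MSCAlg B)) → ∃ c : Canon F, Iso F c.Alg (MSCAlg A) := by
    intro p q r s hd h
    obtain ⟨B, hB⟩ := exists_basisChange A hd
    obtain ⟨f, hf⟩ := hB.iso.symm
    obtain ⟨u, v, huv⟩ := hne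
    obtain ⟨c, hc⟩ := h B hB ⟨f u, f v, by rwa [← hf, Ne, LinearEquiv.map_eq_zero_iff]⟩
    exact ⟨c, hc.trans hB.iso⟩
  by_cases hD : m₁ * l₂ - m₂ * l₁ = 0
  · by_cases hm : m₁ = 0 ∧ m₂ = 0
    · by_cases hl : l₁ = 0 ∧ l₂ = 0
      · obtain ⟨rfl, rfl⟩ := hm
        obtain ⟨rfl, rfl⟩ := hl
        by_cases h03 : A 0 3 = 0
        · exact TraceForm.exists_canon_zero hF ⟨hl₁, hl₂, hm₁, hm₂⟩ h03 hne
        · -- a vector that is proportional to its square is taken as `e₂`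
          obtain ⟨t, ht⟩ := exists_cubic_root hF 0 0 (-(A 1 0 / A 0 3))
          refine pass 0 1 1 t (by simp) fun B hB hneB => ?_
          refine TraceForm.exists_canon_zero hF ⟨?_, ?_, ?_, ?_⟩ ?_ hneB
          · rw [hB.trL₁, hl₁, hl₂]; ring
          · rw [hB.trL₂, hl₁, hl₂]; ring
          · rw [hB.trR₁, hm₁, hm₂]; ring
          · rw [hB.trR₂, hm₁, hm₂]; ring
          · have := hB.x22; have := hB.y22
            grind
      · obtain ⟨p, q, hpq⟩ : ∃ p q, p * l₁ + q * l₂ = 1 := by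
          by_cases h : l₁ = 0
          · exact ⟨0, 1 / l₂, by grind⟩
          · exact ⟨1 / l₁, 0, by grind⟩
        refine pass p q (-l₂) l₁ (by grind) fun B hB _ =>
          TraceForm.exists_canon hF (l := 1) (m := 0) ⟨?_, ?_, ?_, ?_⟩ (by simp)
        · rw [hB.trL₁, hl₁, hl₂, hpq]
        · rw [hB.trL₂, hl₁, hl₂]; ring
        · rw [hB.trR₁, hm₁, hm₂, hm.1, hm.2]; ring
        · rw [hB.trR₂, hm₁, hm₂, hm.1, hm.2]; ring
    · obtain ⟨p, q, hpq⟩ : ∃ p q, p * m₁ + q * m₂ = 1 := by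
        by_cases h : m₁ = 0
        · exact ⟨0, 1 / m₂, by grind⟩
        · exact ⟨1 / m₁, 0, by grind⟩
      refine pass p q (-m₂) m₁ (by grind) fun B hB _ =>
        TraceForm.exists_canon hF (m := 1) ⟨rfl, ?_, ?_, ?_⟩ (by simp)
      · rw [hB.trL₂, hl₁, hl₂]; linear_combination hD
      · rw [hB.trR₁, hm₁, hm₂, hpq]
      · rw [hB.trR₂, hm₁, hm₂]; ring
  · -- the basis dual to the two trace forms
    obtain ⟨d, hd⟩ : ∃ d, (m₁ * l₂ - m₂ * l₁) * d = 1 := ⟨_, mul_inv_cancel₀ hD⟩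
    refine pass (l₂ * d) (-l₁ * d) (-m₂ * d) (m₁ * d) (by grind) fun B hB _ => ?_
    suffices ∃ c : Canon F, c.msc = B by
      obtain ⟨c, rfl⟩ := this
      exact ⟨c, LinearEquiv.refl F _, fun _ _ => rfl⟩
    have t1 := hB.trL₁
    have t2 := hB.trL₂
    have t3 := hB.trR₁
    have t4 := hB.trR₂
    rw [hl₁, hl₂] at t1 t2
    rw [hm₁, hm₂] at t3 t4
    exact ⟨A1 (B 0 0) (B 0 1) (B 0 3) (B 1 0), by apply msc_ext <;> simp [msc] <;> grind⟩

end Existence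

/-! ### Uniqueness of the canonical form -/

namespace Canon

variable {F : Type*} [Field F] [CharP F 3]

set_option maxHeartbeats 8000000 in
/-- The trace forms separate the groups `A₁`, `A₂`–`A₅`, `A₆`–`A₈` and `A₉`–`A₁₂` from one
another. They force the change of basis to be the identity for `A₁`, and force `p = 1`, `r = 0` in
the next two groups; the products then fix the parameters, except that `e₂ e₂ = e₁` leaves the
sign of `s` free in `A₂` and `A₆`. -/
theorem same_of_basisChange {c c' : Canon F} {p q r s : F}
    (h : BasisChange c.msc c'.msc p q r s) : Same c c' := by
  have h3 : (3 : F) = 0 := CharP.cast_eq_zero F 3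
  have trL₁ := h.trL₁
  have trL₂ := h.trL₂
  have trR₁ := h.trR₁
  have trR₂ := h.trR₂
  obtain ⟨hd, x11, y11, x12, y12, x21, y21, x22, y22⟩ := h
  cases c <;> cases c' <;>
    simp only [msc, Matrix.of_apply, Matrix.cons_val', Matrix.cons_val] at *
  case A2.A2 a b c a' b' c' =>
    obtain ⟨rfl, rfl, rfl | rfl⟩ : a = a' ∧ c = c' ∧ (b' = b ∨ b' = -b) := by grind
    · exact .refl _
    · exact .sign2 _ _ _
  case A6.A6 a b a' b' =>
    obtain ⟨rfl, rfl | rfl⟩ : a = a' ∧ (b' = b ∨ b' = -b) := by grind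
    · exact .refl _
    · exact .sign6 _ _
  case A1.A1 a b c d a' b' c' d' =>
    obtain ⟨rfl, rfl, rfl, rfl⟩ : a = a' ∧ b = b' ∧ c = c' ∧ d = d' := by grind
    exact .refl _
  case A3.A3 a b a' b' =>
    obtain ⟨rfl, rfl⟩ : a = a' ∧ b = b' := by grind
    exact .refl _
  case A4.A4 a b a' b' =>
    obtain ⟨rfl, rfl⟩ : a = a' ∧ b = b' := by grind
    exact .refl _
  case A5.A5 a a' =>
    obtain rfl : a = a' := by grind
    exact .refl _
  case A7.A7 a a' =>
    obtain rfl : a = a' := by grind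
    exact .refl _
  case A8.A8 a a' =>
    obtain rfl : a = a' := by grind
    exact .refl _
  all_goals first | exact .refl _ | exfalso
  all_goals grind

end Canon

namespace Canon

variable {F : Type*} [Field F]

theorem iso_of_same {c c' : Canon F} (h : Same c c') : Iso F c.Alg c'.Alg := by
  cases h with
  | refl => exact ⟨LinearEquiv.refl F _, fun _ _ => rfl⟩
  | sign2 =>
    exact BasisChange.iso (F := F) (p := 1) (q := 0) (r := 0) (s := -1)
      (by constructor <;> simp [msc])
  | sign6 =>
    exact BasisChange.iso (F := F) (p := 1) (q := 0) (r := 0) (s := -1)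
      (by constructor <;> simp [msc])

theorem iso_iff_same [CharP F 3] {c c' : Canon F} : Iso F c.Alg c'.Alg ↔ Same c c' := by
  refine ⟨fun h => ?_, iso_of_same⟩
  obtain ⟨p, q, r, s, h⟩ := Iso.exists_basisChange h
  exact same_of_basisChange h

/-- The four lists are exhaustive and give four different cardinalities, so the counts on the
lists determine the lists. -/
theorem encard_iff_list [CharP F 3] (hF : HasRootsTwoThree F) (c : Canon F) :
    ((nontrivialSubalgebras F c.Alg).encard = 1 ↔ c.listOne) ∧
    ((nontrivialSubalgebras F c.Alg).encard = 2 ↔ c.listTwo) ∧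
    ((nontrivialSubalgebras F c.Alg).encard = 3 ↔ c.listThree) ∧
    ((nontrivialSubalgebras F c.Alg).Infinite ↔ c.listInfinite) := by
  have h1 := encard_closedLines_of_listOne hF (c := c)
  have h2 := encard_closedLines_of_listTwo (c := c)
  have h3 := encard_closedLines_of_listThree hF (c := c)
  have h4 := infinite_closedLines_of_listInfinite hF (c := c)
  rw [← Set.encard_eq_top_iff] at h4 ⊢
  rw [encard_nontrivialSubalgebras]
  have h12 : (1 : ℕ∞) ≠ 2 := by decide
  have h13 : (1 : ℕ∞) ≠ 3 := by decide
  have h23 : (2 : ℕ∞) ≠ 3 := by decide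
  have h1t : (1 : ℕ∞) ≠ ⊤ := by decide
  have h2t : (2 : ℕ∞) ≠ ⊤ := by decide
  have h3t : (3 : ℕ∞) ≠ ⊤ := by decide
  have := mem_some_list c
  grind

end Canon

end TwoDimAlg

theorem theorem3p3 {F : Type*} [Field F] [CharP F 3]
    (hF : ∀ p : F[X], p.natDegree = 2 ∨ p.natDegree = 3 → ∃ x : F, p.IsRoot x) :
    -- the number of nontrivial subalgebras of each canonical algebra
    (∀ c : Canon F,
      ((nontrivialSubalgebras F c.Alg).encard = 1 ↔ c.listOne) ∧
      ((nontrivialSubalgebras F c.Alg).encard = 2 ↔ c.listTwo) ∧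
      ((nontrivialSubalgebras F c.Alg).encard = 3 ↔ c.listThree) ∧
      ((nontrivialSubalgebras F c.Alg).Infinite ↔ c.listInfinite)) ∧
    -- every nontrivial two-dimensional algebra with such a number of nontrivial subalgebras is
    -- isomorphic to one, and up to the sign identification only one, canonical algebra, and
    -- that one is in the corresponding list
    (∀ (V : Type*) [NonUnitalNonAssocRing V] [Module F V] [IsScalarTower F V V]
      [SMulCommClass F V V], Module.finrank F V = 2 → (∃ x y : V, x * y ≠ 0) →
      ((nontrivialSubalgebras F V).encard = 1 →
        ∃ c : Canon F, c.listOne ∧ ∀ c' : Canon F, Iso F V c'.Alg ↔ Canon.Same c c') ∧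
      ((nontrivialSubalgebras F V).encard = 2 →
        ∃ c : Canon F, c.listTwo ∧ ∀ c' : Canon F, Iso F V c'.Alg ↔ Canon.Same c c') ∧
      ((nontrivialSubalgebras F V).encard = 3 →
        ∃ c : Canon F, c.listThree ∧ ∀ c' : Canon F, Iso F V c'.Alg ↔ Canon.Same c c') ∧
      ((nontrivialSubalgebras F V).Infinite →
        ∃ c : Canon F, c.listInfinite ∧ ∀ c' : Canon F, Iso F V c'.Alg ↔ Canon.Same c c')) := by
  refine ⟨Canon.encard_iff_list hF, fun V _ _ _ _ hV hne => ?_⟩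
  obtain ⟨A, hA⟩ := exists_iso_mscAlg hV
  have hneA : ∃ u v : MSCAlg A, u * v ≠ 0 := by
    obtain ⟨f, hf⟩ := hA.symm
    obtain ⟨x, y, hxy⟩ := hne
    exact ⟨f x, f y, by rwa [← hf, Ne, LinearEquiv.map_eq_zero_iff]⟩
  obtain ⟨c, hc⟩ := exists_canon_iso hF hneA
  have hVc : Iso F V c.Alg := (hc.trans hA).symm
  have huniq : ∀ c' : Canon F, Iso F V c'.Alg ↔ Canon.Same c c' := fun c' =>
    ⟨fun h => Canon.iso_iff_same.1 (hVc.symm.trans h),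
      fun h => hVc.trans (Canon.iso_iff_same.2 h)⟩
  obtain ⟨k1, k2, k3, k4⟩ := Canon.encard_iff_list hF c
  rw [← Set.encard_eq_top_iff] at k4 ⊢
  rw [hVc.encard_nontrivialSubalgebras]
  exact ⟨fun h => ⟨c, k1.1 h, huniq⟩, fun h => ⟨c, k2.1 h, huniq⟩, fun h => ⟨c, k3.1 h, huniq⟩,
    fun h => ⟨c, k4.1 h, huniq⟩⟩
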